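/- Let $n\ge 3$, let $\Delta_n=\{x\in\mathbb{R}^n: x_i\ge 0 \text{ for all } i,\ \sum_i x_i=1\}$ with vertices $e_1,\dots,e_n$ (the canonical basis of $\mathbb{R}^n$), let $\widetilde\Delta_n=\Delta_n\setminus\{e_1,\dots,e_n\}$ and $\mathrm{int}(\Delta_n)=\{x\in\mathbb{R}^n: x_i>0\text{ for all } i,\ \sum_i x_i=1\}$. Let $C_1,C_2\in\mathbb{R}^{n\times n}$ be row-stochastic (nonnegative entries, row sums $1$) and irreducible matrices with zero diagonal. Assume that neither $C_1$ nor $C_2$ has star topology, where a matrix $C$ has star topology if there is an index $k$ such that $C_{ij}>0$ implies $i=k$ or $j=k$. For $p=1,2$ let $c_p=(c_{1,p},\dots,c_{n,p})^\top$ be the dominant left eigenvector of $C_p$, that is, the unique vector with $c_p^\top C_p=c_p^\top$ and $\sum_i c_{i,p}=1$. Put $$\alpha_p(x)=\frac{1}{\sum_{i=1}^n \frac{c_{i,p}}{1-x_i}},\qquad F_p(e_i)=e_i\ (1\le i\le n),\qquad F_p(x)=\alpha_p(x)\Big(\frac{c_{1,p}}{1-x_1},\dots,\frac{c_{n,p}}{1-x_n}\Big)^{\!\top}\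 \text{ if } x\notin\{e_1,\dots,e_n\},$$ and let $F_3=F_2\circ F_1$ and $F_4=F_1\circ F_2$. Then the following hold. (P1) For every $y\in\widetilde\Delta_n$ one has $F_1(y)\in\widetilde\Delta_n$ (so that $\alpha_2(F_1(y))$ is well defined) and $\alpha_2(F_1(y))>0$. (P2) $F_3(e_i)=e_i$ for every $i$. (P3) $F_3$ maps $\Delta_n$ into $\Delta_n$ and is continuous on $\Delta_n$. (P4) $F_3$ has at least one fixed point in $\mathrm{int}(\Delta_n)$. The same holds for $F_4$: (P2)–(P4) hold with $F_4$ in place of $F_3$, and for every $y\in\widetilde\Delta_n$ one has $F_2(y)\in\widetilde\Delta_n$ and $\alpha_1(F_2(y))>0$. -/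

import Mathlib

namespace DeGrootFriedkin

variable {n : ℕ}

/-- The vertex `e_i` of the simplex, that is, the `i`-th canonical basis vector of `ℝⁿ`. -/
def vertex (i : Fin n) : Fin n → ℝ := Pi.single i 1

/-- The simplex `Δ_n` with its vertices removed. -/
def simplexOffVertices (n : ℕ) : Set (Fin n → ℝ) :=
  stdSimplex ℝ (Fin n) \ Set.range vertex

/-- The interior of the simplex: `0 < x_i` for all `i`, and `∑ i, x_i = 1`. -/
def simplexInterior (n : ℕ) : Set (Fin n → ℝ) :=
  {x | (∀ i, 0 < x i) ∧ ∑ i, x i = 1}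

/-- The digraph of `C` (an edge between `i` and `j`, directed from `j` to `i`, whenever
`0 < C i j`) has star topology: some node `k` is an endpoint of every edge. -/
def HasStarTopology (C : Matrix (Fin n) (Fin n) ℝ) : Prop :=
  ∃ k, ∀ i j, 0 < C i j → i = k ∨ j = k

/-- `c` is a left eigenvector of `C` for the eigenvalue `1`, normalised by `∑ i, c i = 1`. -/
def IsDominantLeftEigenvector (C : Matrix (Fin n) (Fin n) ℝ) (c : Fin n → ℝ) : Prop :=
  Matrix.vecMul c C = c ∧ ∑ i, c i = 1

open Classical in
/-- The dominant left eigenvector of `C`. For an irreducible row-stochastic matrix there is exactly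
one vector satisfying `IsDominantLeftEigenvector C`; the value `0` is used only if there is none. -/
noncomputable def dominantLeftEigenvector (C : Matrix (Fin n) (Fin n) ℝ) : Fin n → ℝ :=
  if h : ∃ c, IsDominantLeftEigenvector C c then h.choose else 0

/-- The normaliser `α(x) = 1 / ∑ i, c_i / (1 - x_i)`, with `c` the dominant left eigenvector
of `C`. -/
noncomputable def normaliser (C : Matrix (Fin n) (Fin n) ℝ) (x : Fin n → ℝ) : ℝ :=
  1 / ∑ i, dominantLeftEigenvector C i / (1 - x i)

open Classical in
/-- The self-appraisal map `F` of `C`: `F(e_i) = e_i` for every vertex `e_i`, and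
`F(x) = α(x) (c_1 / (1 - x_1), …, c_n / (1 - x_n))` for every other `x`. -/
noncomputable def selfAppraisalMap (C : Matrix (Fin n) (Fin n) ℝ) (x : Fin n → ℝ) : Fin n → ℝ :=
  if x ∈ Set.range (vertex (n := n)) then x
  else fun i => normaliser C x * (dominantLeftEigenvector C i / (1 - x i))

end DeGrootFriedkin

/-!
Each self-appraisal map is, on the whole simplex, a quotient of polynomials: multiplying numerators
and denominator by `∏ l, (1 - x l)` removes the poles at the vertices, and the new denominator is
positive there (`selfAppraisalMap_eq_clearedMap`, `clearedMap_denom_pos`). This gives continuity.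
All that is needed of a dominant left eigenvector `c` is that it is positive (Perron–Frobenius,
obtained by comparing `c` with `|c|`) and that its entries are below `1/2`. The bound `c k ≤ 1/2`
holds because the diagonal of `C` vanishes, and equality would send every row `i ≠ k` to `k`,
which is a star.

The fixed point of a composition comes from the intermediate value theorem in one variable rather
than from Brouwer's theorem. A fixed point `x` of `F₂ ∘ F₁`, together with `y = F₁ x`, solves
`y i * (1 - x i) = s * c i` and `x i * (1 - y i) = t * d i`. Subtracting gives
`y i - x i = s * c i - t * d i`, and summing over `i` gives `s = t`. Hence
`y i - x i = s * (c i - d i)`, and `1 - x i - y i` is a square root of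
`D i s = 1 - 2 s (c i + d i) + s² (c i - d i)²`. What remains is to find `s > 0` and signs with
`∑ i, ± √(D i s) = n - 2` (`exists_signed_sqrt_sum_eq`). All `D i` are nonnegative up to the first
time `S` at which one of them, say `D k`, vanishes. With all signs `+` the sum is `n` at `s = 0`. If
it is at most `n - 2` at `S`, continuity ends the search. Otherwise the sign of the `k`-th root is
flipped, which does not change the value at `S`; the sum is then `n - 2` at `0` with derivative
`-2 + 2 (c k + d k) < 0`, so it lies below `n - 2` for small `s` and above it at `S`.
-/

namespace DeGrootFriedkin

variable {n : ℕ}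

/-! ### The simplex and its vertices -/

theorem lt_one_of_mem_simplexOffVertices {x : Fin n → ℝ} (hx : x ∈ simplexOffVertices n)
    (i : Fin n) : x i < 1 := by
  obtain ⟨⟨h0, h1⟩, hv⟩ := hx
  refine lt_of_le_of_ne (h1 ▸ Finset.single_le_sum (fun j _ => h0 j) (Finset.mem_univ i)) ?_
  intro hi
  refine hv ⟨i, ?_⟩
  have hrest : ∑ j ∈ Finset.univ.erase i, x j = 0 := by
    have := Finset.add_sum_erase Finset.univ x (Finset.mem_univ i)
    linarith
  rw [Finset.sum_eq_zero_iff_of_nonneg (fun j _ => h0 j)] at hrest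
  funext j
  by_cases hj : j = i
  · subst hj; simp [vertex, hi]
  · simp [vertex, hj, hrest j (by simp [hj])]

theorem simplexInterior_subset_simplexOffVertices (hn : 2 ≤ n) :
    simplexInterior n ⊆ simplexOffVertices n := by
  rintro x ⟨h0, h1⟩
  refine ⟨⟨fun i => (h0 i).le, h1⟩, ?_⟩
  rintro ⟨i, rfl⟩
  have : Nontrivial (Fin n) := Fin.nontrivial_iff_two_le.2 hn
  obtain ⟨j, hj⟩ := exists_ne i
  have := h0 j
  simp [vertex, hj] at this

theorem vertex_mem_stdSimplex (i : Fin n) : vertex i ∈ stdSimplex ℝ (Fin n) :=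
  single_mem_stdSimplex ℝ i

/-! ### The dominant left eigenvector -/

section Eigenvector

variable {C : Matrix (Fin n) (Fin n) ℝ}

/-- A nonnegative invariant vector of an irreducible matrix is positive as soon as one of its
entries is: positivity spreads along the powers of the matrix. -/
theorem pos_of_vecMul_eq_self (hirr : C.IsIrreducible) {v : Fin n → ℝ}
    (hv : Matrix.vecMul v C = v) (h0 : ∀ i, 0 ≤ v i) {k : Fin n} (hk : 0 < v k) (j : Fin n) :
    0 < v j := by
  obtain ⟨m, -, hm⟩ := (Matrix.isIrreducible_iff_exists_pow_pos hirr.nonneg).1 hirr k j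
  have hpow : ∀ m : ℕ, Matrix.vecMul v (C ^ m) = v := by
    intro m
    induction m with
    | zero => simp
    | succ m ih => rw [pow_succ, ← Matrix.vecMul_vecMul, ih, hv]
  rw [← hpow m]
  exact Finset.sum_pos' (f := fun i => v i * (C ^ m) i j)
    (fun i _ => mul_nonneg (h0 i) (Matrix.pow_apply_nonneg hirr.nonneg m i j))
    ⟨k, Finset.mem_univ k, mul_pos hk hm⟩

/-- Row-stochastic matrices do not expand the `ℓ¹` norm, so the entrywise inequality
`|v| ≤ |v| C` for an invariant vector `v` is an equality. -/
theorem abs_vecMul_eq_self (hrow : C ∈ Matrix.rowStochastic ℝ (Fin n)) {v : Fin n → ℝ}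
    (hv : Matrix.vecMul v C = v) : Matrix.vecMul (fun i => |v i|) C = fun i => |v i| := by
  have hle : ∀ j ∈ Finset.univ, |v j| ≤ Matrix.vecMul (fun i => |v i|) C j := by
    intro j _
    conv_lhs => rw [← hv]
    refine (Finset.abs_sum_le_sum_abs (fun i => v i * C i j) Finset.univ).trans (le_of_eq ?_)
    refine Finset.sum_congr rfl fun i _ => ?_
    rw [abs_mul, abs_of_nonneg (hrow.1 i j)]
  have hsum : ∑ j, |v j| = ∑ j, Matrix.vecMul (fun i => |v i|) C j := by
    simp only [Matrix.vecMul, dotProduct]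
    rw [Finset.sum_comm]
    refine Finset.sum_congr rfl fun i _ => ?_
    rw [← Finset.mul_sum, Matrix.sum_row_of_mem_rowStochastic hrow, mul_one]
  funext j
  exact ((Finset.sum_eq_sum_iff_of_le hle).1 hsum j (Finset.mem_univ j)).symm

theorem exists_isDominantLeftEigenvector (hn : 0 < n)
    (hrow : C ∈ Matrix.rowStochastic ℝ (Fin n)) : ∃ c, IsDominantLeftEigenvector C c := by
  have : Nonempty (Fin n) := ⟨⟨0, hn⟩⟩
  have hdet : (C - 1).det = 0 :=
    Matrix.exists_mulVec_eq_zero_iff.1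
      ⟨1, one_ne_zero, by rw [Matrix.sub_mulVec, hrow.2, Matrix.one_mulVec, sub_self]⟩
  obtain ⟨v, hv0, hv⟩ := Matrix.exists_vecMul_eq_zero_iff.2 hdet
  rw [Matrix.vecMul_sub, Matrix.vecMul_one, sub_eq_zero] at hv
  have habs := abs_vecMul_eq_self hrow hv
  obtain ⟨k, hk⟩ := Function.ne_iff.1 hv0
  have hpos : 0 < ∑ i, |v i| :=
    Finset.sum_pos' (fun i _ => abs_nonneg _) ⟨k, Finset.mem_univ k, abs_pos.2 hk⟩
  refine ⟨(∑ i, |v i|)⁻¹ • fun i => |v i|, ?_, ?_⟩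
  · rw [Matrix.smul_vecMul, habs]
  · simp only [Pi.smul_apply, smul_eq_mul]
    rw [← Finset.mul_sum, inv_mul_cancel₀ hpos.ne']

theorem isDominantLeftEigenvector_dominantLeftEigenvector (hn : 0 < n)
    (hrow : C ∈ Matrix.rowStochastic ℝ (Fin n)) :
    IsDominantLeftEigenvector C (dominantLeftEigenvector C) := by
  have h := exists_isDominantLeftEigenvector hn hrow
  rw [dominantLeftEigenvector, dif_pos h]
  exact h.choose_spec

theorem IsDominantLeftEigenvector.pos (hrow : C ∈ Matrix.rowStochastic ℝ (Fin n))
    (hirr : C.IsIrreducible) {c : Fin n → ℝ} (hc : IsDominantLeftEigenvector C c) (j : Fin n) :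
    0 < c j := by
  obtain ⟨hinv, hsum⟩ := hc
  have hnonneg : ∀ i, 0 ≤ c i := by
    by_contra! hneg
    obtain ⟨k, hk⟩ := hneg
    -- If `c k < 0`, the invariant vector `|c| - c` has a positive entry, so `c` is negative
    -- throughout, against its sum being `1`.
    have hdiff : Matrix.vecMul ((fun i => |c i|) - c) C = (fun i => |c i|) - c := by
      rw [Matrix.sub_vecMul, abs_vecMul_eq_self hrow hinv, hinv]
    have hall := pos_of_vecMul_eq_self hirr hdiff
      (fun i => sub_nonneg.2 (le_abs_self (c i))) (k := k)
      (sub_pos.2 (hk.trans_le (abs_nonneg _)))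
    have : ∑ i, c i ≤ 0 := by
      refine Finset.sum_nonpos fun i _ => ?_
      by_contra! hi
      have := hall i
      simp [abs_of_pos hi] at this
    linarith
  obtain ⟨k, -, hk⟩ : ∃ k ∈ Finset.univ, 0 < c k := by
    refine Finset.exists_lt_of_sum_lt (f := fun _ => (0 : ℝ)) ?_
    simp [hsum]
  exact pos_of_vecMul_eq_self hirr hinv hnonneg hk j

theorem IsDominantLeftEigenvector.lt_half (hrow : C ∈ Matrix.rowStochastic ℝ (Fin n))
    (hdiag : ∀ i, C i i = 0) (hstar : ¬ HasStarTopology C) {c : Fin n → ℝ}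
    (hc : IsDominantLeftEigenvector C c) (hpos : ∀ i, 0 < c i) (k : Fin n) : c k < 1 / 2 := by
  obtain ⟨hinv, hsum⟩ := hc
  have hk : ∑ i ∈ Finset.univ.erase k, c i * C i k = c k := by
    have h1 := congrFun hinv k
    have h2 := Finset.add_sum_erase Finset.univ (fun i => c i * C i k) (Finset.mem_univ k)
    simp only [Matrix.vecMul, dotProduct] at h1
    rw [hdiag, mul_zero, zero_add] at h2
    rw [h2, h1]
  have hrest : ∑ i ∈ Finset.univ.erase k, c i = 1 - c k := by
    have := Finset.add_sum_erase Finset.univ c (Finset.mem_univ k)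
    linarith
  have hle : ∀ i ∈ Finset.univ.erase k, c i * C i k ≤ c i := fun i _ =>
    mul_le_of_le_one_right (hpos i).le (Matrix.le_one_of_mem_rowStochastic hrow)
  -- No star at `k`: some `i ≠ k` puts weight on a `j ≠ k`, hence less than `1` on `k`.
  obtain ⟨i, j, hij, hik, hjk⟩ : ∃ i j, 0 < C i j ∧ i ≠ k ∧ j ≠ k := by
    by_contra! hcon
    exact hstar ⟨k, fun i j hij => or_iff_not_imp_left.2 (hcon i j hij)⟩
  have hlt : C i k < 1 := by
    have h1 := Matrix.sum_row_of_mem_rowStochastic hrow i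
    have h2 := Finset.add_sum_erase Finset.univ (C i) (Finset.mem_univ k)
    have h3 : C i j ≤ ∑ l ∈ Finset.univ.erase k, C i l :=
      Finset.single_le_sum (fun l _ => hrow.1 i l) (by simp [hjk])
    linarith
  have := Finset.sum_lt_sum hle
    ⟨i, by simp [hik], mul_lt_of_lt_one_right (hpos i) hlt⟩
  linarith

end Eigenvector

/-! ### The self-appraisal map on the simplex -/

/-- The self-appraisal map with denominators cleared: numerator and denominator are multiplied
by `∏ l, (1 - x l)`. The formula makes sense at the vertices as well. -/
noncomputable def clearedMap (c x : Fin n → ℝ) (i : Fin n) : ℝ :=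
  c i * (∏ l ∈ Finset.univ.erase i, (1 - x l)) /
    ∑ m, c m * ∏ l ∈ Finset.univ.erase m, (1 - x l)

theorem prod_erase_vertex (k i : Fin n) :
    ∏ l ∈ Finset.univ.erase i, (1 - vertex k l) = if i = k then 1 else 0 := by
  split_ifs with h
  · subst h
    refine Finset.prod_eq_one fun l hl => ?_
    simp [vertex, Finset.ne_of_mem_erase hl]
  · exact Finset.prod_eq_zero (i := k) (by simp [Ne.symm h]) (by simp [vertex])

theorem clearedMap_denom_pos (hn : 0 < n) {c x : Fin n → ℝ} (hc : ∀ i, 0 < c i)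
    (hx : x ∈ stdSimplex ℝ (Fin n)) :
    0 < ∑ m, c m * ∏ l ∈ Finset.univ.erase m, (1 - x l) := by
  by_cases hv : x ∈ Set.range (vertex (n := n))
  · obtain ⟨k, rfl⟩ := hv
    simpa [prod_erase_vertex] using hc k
  · have : Nonempty (Fin n) := ⟨⟨0, hn⟩⟩
    exact Finset.sum_pos (fun m _ => mul_pos (hc m) (Finset.prod_pos fun l _ =>
      sub_pos.2 (lt_one_of_mem_simplexOffVertices ⟨hx, hv⟩ l))) Finset.univ_nonempty

theorem selfAppraisalMap_vertex (C : Matrix (Fin n) (Fin n) ℝ) (i : Fin n) :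
    selfAppraisalMap C (vertex i) = vertex i :=
  if_pos ⟨i, rfl⟩

section SelfAppraisal

variable {C : Matrix (Fin n) (Fin n) ℝ}

theorem normaliser_pos (hn : 0 < n) (hc : ∀ i, 0 < dominantLeftEigenvector C i) {x : Fin n → ℝ}
    (hx : x ∈ simplexOffVertices n) : 0 < normaliser C x := by
  have : Nonempty (Fin n) := ⟨⟨0, hn⟩⟩
  exact one_div_pos.2 (Finset.sum_pos (fun i _ => div_pos (hc i)
    (sub_pos.2 (lt_one_of_mem_simplexOffVertices hx i))) Finset.univ_nonempty)

theorem selfAppraisalMap_mem_simplexInterior (hn : 0 < n)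
    (hc : ∀ i, 0 < dominantLeftEigenvector C i) {x : Fin n → ℝ} (hx : x ∈ simplexOffVertices n) :
    selfAppraisalMap C x ∈ simplexInterior n := by
  have hα := normaliser_pos hn hc hx
  rw [selfAppraisalMap, if_neg hx.2]
  refine ⟨fun i => mul_pos hα (div_pos (hc i)
    (sub_pos.2 (lt_one_of_mem_simplexOffVertices hx i))), ?_⟩
  rw [← Finset.mul_sum, normaliser]
  exact one_div_mul_cancel (one_div_pos.1 hα).ne'

theorem selfAppraisalMap_eq_clearedMap (hc : ∀ i, 0 < dominantLeftEigenvector C i)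
    {x : Fin n → ℝ} (hx : x ∈ stdSimplex ℝ (Fin n)) :
    selfAppraisalMap C x = clearedMap (dominantLeftEigenvector C) x := by
  by_cases hv : x ∈ Set.range (vertex (n := n))
  · obtain ⟨k, rfl⟩ := hv
    rw [selfAppraisalMap_vertex]
    funext i
    simp only [clearedMap, prod_erase_vertex, mul_ite, mul_one, mul_zero, Finset.sum_ite_eq',
      Finset.mem_univ, if_true]
    by_cases hi : i = k
    · subst hi; simp [vertex, (hc i).ne']
    · simp [vertex, hi]
  · have hne : ∀ i, 1 - x i ≠ 0 := fun i =>
      (sub_pos.2 (lt_one_of_mem_simplexOffVertices ⟨hx, hv⟩ i)).ne'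
    have hP : ∏ l, (1 - x l) ≠ 0 := Finset.prod_ne_zero_iff.2 fun i _ => hne i
    have hterm : ∀ i, dominantLeftEigenvector C i * (∏ l ∈ Finset.univ.erase i, (1 - x l)) =
        (∏ l, (1 - x l)) * (dominantLeftEigenvector C i / (1 - x i)) := by
      intro i
      rw [← Finset.mul_prod_erase Finset.univ (fun l => 1 - x l) (Finset.mem_univ i)]
      have := hne i
      field_simp
    rw [selfAppraisalMap, if_neg hv]
    funext i
    simp only [clearedMap, hterm]
    rw [← Finset.mul_sum, mul_div_mul_left _ _ hP, normaliser, one_div_mul_eq_div]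

theorem continuousOn_selfAppraisalMap (hn : 0 < n) (hc : ∀ i, 0 < dominantLeftEigenvector C i) :
    ContinuousOn (selfAppraisalMap C) (stdSimplex ℝ (Fin n)) := by
  refine ContinuousOn.congr ?_ fun x hx => selfAppraisalMap_eq_clearedMap hc hx
  refine continuousOn_pi.2 fun i => ContinuousOn.div ?_ ?_ fun x hx =>
    (clearedMap_denom_pos hn hc hx).ne'
  · fun_prop
  · fun_prop

theorem mapsTo_selfAppraisalMap (hn : 2 ≤ n) (hc : ∀ i, 0 < dominantLeftEigenvector C i) :
    Set.MapsTo (selfAppraisalMap C) (stdSimplex ℝ (Fin n)) (stdSimplex ℝ (Fin n)) := by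
  intro x hx
  by_cases hv : x ∈ Set.range (vertex (n := n))
  · obtain ⟨k, rfl⟩ := hv
    rw [selfAppraisalMap_vertex]
    exact vertex_mem_stdSimplex k
  · exact (simplexInterior_subset_simplexOffVertices hn
      (selfAppraisalMap_mem_simplexInterior (by omega) hc ⟨hx, hv⟩)).1

/-- The value of the self-appraisal map is determined by the equations `y i (1 - x i) = s c i`:
summing them forces the multiplier `s` to be the normaliser. -/
theorem selfAppraisalMap_eq_of_mul_eq (hn : 2 ≤ n) {x y : Fin n → ℝ} {s : ℝ} (hs : 0 < s)
    (hx : x ∈ simplexInterior n) (hy : ∑ i, y i = 1)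
    (h : ∀ i, y i * (1 - x i) = s * dominantLeftEigenvector C i) : selfAppraisalMap C x = y := by
  have hx' := simplexInterior_subset_simplexOffVertices hn hx
  have hdiv : ∀ i, dominantLeftEigenvector C i / (1 - x i) = y i / s := by
    intro i
    rw [div_eq_div_iff (sub_pos.2 (lt_one_of_mem_simplexOffVertices hx' i)).ne' hs.ne', h i,
      mul_comm]
  rw [selfAppraisalMap, if_neg hx'.2]
  funext i
  simp only [normaliser, hdiv]
  rw [← Finset.sum_div, hy, one_div_one_div, mul_div_cancel₀ _ hs.ne']

end SelfAppraisal

/-! ### An interior solution of the coupled equations -/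

/-- The discriminant of the quadratic equation for one coordinate of a fixed point. -/
def discriminant (a b s : ℝ) : ℝ := 1 - 2 * s * (a + b) + s ^ 2 * (a - b) ^ 2

theorem discriminant_eq_mul {a b : ℝ} (ha : 0 ≤ a) (hb : 0 ≤ b) (s : ℝ) :
    discriminant a b s = (1 - s * (√a + √b) ^ 2) * (1 - s * (√a - √b) ^ 2) := by
  have h1 := Real.sq_sqrt ha
  have h2 := Real.sq_sqrt hb
  rw [discriminant]
  generalize √a = u at *
  generalize √b = v at *
  subst h1 h2
  ring

theorem discriminant_nonneg {a b s : ℝ} (ha : 0 ≤ a) (hb : 0 ≤ b) (hs : 0 ≤ s)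
    (h : s * (√a + √b) ^ 2 ≤ 1) : 0 ≤ discriminant a b s := by
  rw [discriminant_eq_mul ha hb]
  have : s * (√a - √b) ^ 2 ≤ s * (√a + √b) ^ 2 := by
    refine mul_le_mul_of_nonneg_left ?_ hs
    nlinarith [mul_nonneg (Real.sqrt_nonneg a) (Real.sqrt_nonneg b)]
  exact mul_nonneg (by linarith) (by linarith)

/-- Upper bound from `√D ≤ (1 + D) / 2`. -/
theorem sqrt_discriminant_le {a b s : ℝ} (ha : 0 ≤ a) (hb : 0 ≤ b) (ha1 : a ≤ 1) (hb1 : b ≤ 1)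
    (hD : 0 ≤ discriminant a b s) :
    √(discriminant a b s) ≤ 1 - s * (a + b) + s ^ 2 / 2 * (a + b) := by
  have h1 : √(discriminant a b s) ≤ (1 + discriminant a b s) / 2 := by
    nlinarith [Real.sq_sqrt hD, sq_nonneg (√(discriminant a b s) - 1)]
  have h2 : (a - b) ^ 2 ≤ a + b := by nlinarith [mul_nonneg ha hb]
  have h3 := mul_le_mul_of_nonneg_left h2 (sq_nonneg s)
  rw [discriminant] at h1 ⊢
  linarith

theorem le_sqrt_discriminant {a b s : ℝ} (ha : 0 ≤ a) (hb : 0 ≤ b) (hab : a + b ≤ 1)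
    (hs : 0 ≤ s) (hs1 : s ≤ 1 / 4) :
    1 - s * (a + b) - 2 * s ^ 2 ≤ √(discriminant a b s) := by
  refine Real.le_sqrt_of_sq_le ?_
  have h1 : s * (a + b) ≤ 1 / 4 := by nlinarith
  have h2 : 4 * (a * b) ≤ 1 := by nlinarith [sq_nonneg (a - b)]
  have h3 : 0 ≤ s ^ 2 * (4 * (1 - s * (a + b)) - 4 * (a * b) - 4 * s ^ 2) :=
    mul_nonneg (sq_nonneg s) (by nlinarith)
  rw [discriminant]
  linarith

/-- For some `s > 0`, before any discriminant has become negative, square roots of the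
discriminants can be chosen with sum `n - 2`. -/
theorem exists_signed_sqrt_sum_eq {c d : Fin n → ℝ} (hn : 0 < n) (hc : ∀ i, 0 < c i)
    (hd : ∀ i, 0 < d i) (hc2 : ∀ i, c i < 1 / 2) (hd2 : ∀ i, d i < 1 / 2) (hcs : ∑ i, c i = 1)
    (hds : ∑ i, d i = 1) :
    ∃ s : ℝ, 0 < s ∧ (∀ i, s * (√(c i) + √(d i)) ^ 2 ≤ 1) ∧
      ∃ ε : Fin n → ℝ, (∀ i, ε i ^ 2 = discriminant (c i) (d i) s) ∧ ∑ i, ε i = n - 2 := by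
  have : Nonempty (Fin n) := ⟨⟨0, hn⟩⟩
  obtain ⟨k, hk⟩ := Finite.exists_max fun i => (√(c i) + √(d i)) ^ 2
  have hkpos : 0 < (√(c k) + √(d k)) ^ 2 := by
    have := Real.sqrt_pos.2 (hc k)
    have := Real.sqrt_nonneg (d k)
    positivity
  -- `S` is the first zero of a discriminant, attained by the index `k`.
  set S : ℝ := ((√(c k) + √(d k)) ^ 2)⁻¹ with hS
  have hSpos : 0 < S := inv_pos.2 hkpos
  have hbound : ∀ s, 0 ≤ s → s ≤ S → ∀ i, s * (√(c i) + √(d i)) ^ 2 ≤ 1 := by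
    intro s hs hsS i
    calc s * (√(c i) + √(d i)) ^ 2 ≤ S * (√(c k) + √(d k)) ^ 2 :=
          mul_le_mul hsS (hk i) (sq_nonneg _) hSpos.le
      _ = 1 := inv_mul_cancel₀ hkpos.ne'
  have hD : ∀ s, 0 ≤ s → s ≤ S → ∀ i, 0 ≤ discriminant (c i) (d i) s := fun s hs hsS i =>
    discriminant_nonneg (hc i).le (hd i).le hs (hbound s hs hsS i)
  have hcont : ∀ i, Continuous fun s => √(discriminant (c i) (d i) s) := by
    intro i
    unfold discriminant
    fun_prop
  by_cases hG : ∑ i, √(discriminant (c i) (d i) S) ≤ n - 2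
  · have h0 : ∑ i, √(discriminant (c i) (d i) 0) = n := by simp [discriminant]
    obtain ⟨s, ⟨hs0, hsS⟩, hs⟩ := intermediate_value_Icc' hSpos.le
      (f := fun s => ∑ i, √(discriminant (c i) (d i) s))
      (continuous_finsetSum _ fun i _ => hcont i).continuousOn
      (show (n : ℝ) - 2 ∈ _ from ⟨hG, by simp only [h0]; linarith⟩)
    have hspos : 0 < s := by
      refine lt_of_le_of_ne hs0 ?_
      rintro rfl
      simp only [h0] at hs
      linarith
    exact ⟨s, hspos, hbound s hs0 hsS, _, fun i => Real.sq_sqrt (hD s hs0 hsS i), hs⟩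
  · push Not at hG
    set H : ℝ → ℝ := fun s => ∑ i ∈ Finset.univ.erase k, √(discriminant (c i) (d i) s) -
      √(discriminant (c k) (d k) s) with hH
    have hHS : (n : ℝ) - 2 ≤ H S := by
      have hk0 : discriminant (c k) (d k) S = 0 := by
        rw [discriminant_eq_mul (hc k).le (hd k).le, hS, inv_mul_cancel₀ hkpos.ne']
        simp
      have := Finset.add_sum_erase Finset.univ (fun i => √(discriminant (c i) (d i) S))
        (Finset.mem_univ k)
      simp only [hH]
      simp only [hk0, Real.sqrt_zero] at this ⊢
      linarith
    have hγ : 0 < 1 - (c k + d k) := by linarith [hc2 k, hd2 k]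
    -- For `0 < s ≤ min S (1/4)` one has `H s ≤ n - 2 - 2 s (1 - c k - d k) + 3 s²`.
    obtain ⟨t, ht0, htS, ht4, htγ⟩ : ∃ t : ℝ, 0 < t ∧ t ≤ S ∧ t ≤ 1 / 4 ∧
        t ≤ (1 - (c k + d k)) / 3 :=
      ⟨min S (min (1 / 4) ((1 - (c k + d k)) / 3)), by positivity, min_le_left _ _,
        (min_le_right _ _).trans (min_le_left _ _), (min_le_right _ _).trans (min_le_right _ _)⟩
    have hHt : H t ≤ n - 2 := by
      have h1 : ∑ i ∈ Finset.univ.erase k, √(discriminant (c i) (d i) t) ≤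
          ∑ i ∈ Finset.univ.erase k, (1 - t * (c i + d i) + t ^ 2 / 2 * (c i + d i)) :=
        Finset.sum_le_sum fun i _ => sqrt_discriminant_le (hc i).le (hd i).le
          (by linarith [hc2 i]) (by linarith [hd2 i]) (hD t ht0.le htS i)
      have h2 := Finset.add_sum_erase Finset.univ
        (fun i => 1 - t * (c i + d i) + t ^ 2 / 2 * (c i + d i)) (Finset.mem_univ k)
      have h3 : ∑ i, (1 - t * (c i + d i) + t ^ 2 / 2 * (c i + d i)) = n - 2 * t + t ^ 2 := by
        rw [Finset.sum_add_distrib, Finset.sum_sub_distrib, ← Finset.mul_sum, ← Finset.mul_sum,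
          Finset.sum_add_distrib, hcs, hds]
        simp
        ring
      have h4 := le_sqrt_discriminant (hc k).le (hd k).le (by linarith) ht0.le ht4
      have h5 : t * t ≤ t * ((1 - (c k + d k)) / 3) := mul_le_mul_of_nonneg_left htγ ht0.le
      have h6 : 0 ≤ t ^ 2 * (c k + d k) :=
        mul_nonneg (sq_nonneg t) (add_nonneg (hc k).le (hd k).le)
      have h7 : 0 ≤ t * (1 - (c k + d k)) := by positivity
      simp only [hH]
      linarith
    obtain ⟨s, ⟨hst, hsS⟩, hs⟩ := intermediate_value_Icc htS
      (f := H) (by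
        refine Continuous.continuousOn ?_
        exact (continuous_finsetSum _ fun i _ => hcont i).sub (hcont k))
      (show (n : ℝ) - 2 ∈ _ from ⟨hHt, hHS⟩)
    have hspos := ht0.trans_le hst
    refine ⟨s, hspos, hbound s hspos.le hsS,
      fun i => if i = k then -√(discriminant (c i) (d i) s) else √(discriminant (c i) (d i) s),
      fun i => ?_, ?_⟩
    · have := Real.sq_sqrt (hD s hspos.le hsS i)
      dsimp only
      split_ifs <;> simpa using this
    · rw [← Finset.add_sum_erase _ _ (Finset.mem_univ k), if_pos rfl, ← hs]
      simp only [hH]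
      rw [Finset.sum_congr rfl fun i hi => if_neg (Finset.ne_of_mem_erase hi)]
      ring

/-- The coupled equations satisfied by a fixed point `x` of a composition of two self-appraisal
maps and the intermediate point `y` have a solution in the interior of the simplex. -/
theorem exists_interior_solution {c d : Fin n → ℝ} (hn : 0 < n) (hc : ∀ i, 0 < c i)
    (hd : ∀ i, 0 < d i) (hc2 : ∀ i, c i < 1 / 2) (hd2 : ∀ i, d i < 1 / 2) (hcs : ∑ i, c i = 1)
    (hds : ∑ i, d i = 1) :
    ∃ s : ℝ, 0 < s ∧ ∃ x ∈ simplexInterior n, ∃ y ∈ simplexInterior n,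
      (∀ i, y i * (1 - x i) = s * c i) ∧ ∀ i, x i * (1 - y i) = s * d i := by
  obtain ⟨s, hs, hbound, ε, hε, hsum⟩ := exists_signed_sqrt_sum_eq hn hc hd hc2 hd2 hcs hds
  have hlt : ∀ i, s * (c i + d i) ≤ 1 := by
    intro i
    refine le_trans (mul_le_mul_of_nonneg_left ?_ hs.le) (hbound i)
    nlinarith [Real.sq_sqrt (hc i).le, Real.sq_sqrt (hd i).le,
      mul_nonneg (Real.sqrt_nonneg (c i)) (Real.sqrt_nonneg (d i))]
  have hsc : ∀ i, 0 < s * c i := fun i => mul_pos hs (hc i)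
  have hsd : ∀ i, 0 < s * d i := fun i => mul_pos hs (hd i)
  have hprod1 : ∀ i, (1 + s * (c i - d i) - ε i) / 2 * (1 - (1 - s * (c i - d i) - ε i) / 2) =
      s * c i := by
    intro i
    have := hε i
    rw [discriminant] at this
    linear_combination (-1 / 4) * this
  have hprod2 : ∀ i, (1 - s * (c i - d i) - ε i) / 2 * (1 - (1 + s * (c i - d i) - ε i) / 2) =
      s * d i := by
    intro i
    have := hε i
    rw [discriminant] at this
    linear_combination (-1 / 4) * this
  -- Two reals with positive product and positive sum are positive.
  have hpos : ∀ a b : ℝ, 0 < a * b → 0 < a + b → 0 < a := by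
    intro a b hab hadd
    rcases pos_and_pos_or_neg_and_neg_of_mul_pos hab with h | h
    · exact h.1
    · linarith [h.1, h.2]
  have hcd : ∑ i, s * (c i - d i) = 0 := by
    rw [← Finset.mul_sum, Finset.sum_sub_distrib, hcs, hds, sub_self, mul_zero]
  refine ⟨s, hs, fun i => (1 - s * (c i - d i) - ε i) / 2, ⟨fun i => ?_, ?_⟩,
    fun i => (1 + s * (c i - d i) - ε i) / 2, ⟨fun i => ?_, ?_⟩, hprod1, hprod2⟩
  · exact hpos _ _ ((hprod2 i).symm ▸ hsd i) (by linarith [hlt i, hsc i, hsd i])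
  · rw [← Finset.sum_div, Finset.sum_sub_distrib, Finset.sum_sub_distrib, hcd, hsum]
    simp
  · exact hpos _ _ ((hprod1 i).symm ▸ hsc i) (by linarith [hlt i, hsc i, hsd i])
  · rw [← Finset.sum_div, Finset.sum_sub_distrib, Finset.sum_add_distrib, hcd, hsum]
    simp

/-! ### Compositions of two self-appraisal maps -/

/-- The four properties of `selfAppraisalMap C' ∘ selfAppraisalMap C`, for eigenvectors that are
positive with entries below `1/2`. -/
theorem selfAppraisalMap_comp_properties (hn : 2 ≤ n) {C C' : Matrix (Fin n) (Fin n) ℝ}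
    (hc : ∀ i, 0 < dominantLeftEigenvector C i) (hd : ∀ i, 0 < dominantLeftEigenvector C' i)
    (hc2 : ∀ i, dominantLeftEigenvector C i < 1 / 2)
    (hd2 : ∀ i, dominantLeftEigenvector C' i < 1 / 2)
    (hcs : ∑ i, dominantLeftEigenvector C i = 1) (hds : ∑ i, dominantLeftEigenvector C' i = 1) :
    (∀ y ∈ simplexOffVertices n, selfAppraisalMap C y ∈ simplexOffVertices n ∧
        0 < normaliser C' (selfAppraisalMap C y)) ∧
      (∀ i : Fin n, (selfAppraisalMap C' ∘ selfAppraisalMap C) (vertex i) = vertex i) ∧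
      (Set.MapsTo (selfAppraisalMap C' ∘ selfAppraisalMap C)
          (stdSimplex ℝ (Fin n)) (stdSimplex ℝ (Fin n)) ∧
        ContinuousOn (selfAppraisalMap C' ∘ selfAppraisalMap C) (stdSimplex ℝ (Fin n))) ∧
      ∃ y ∈ simplexInterior n, (selfAppraisalMap C' ∘ selfAppraisalMap C) y = y := by
  have hn0 : 0 < n := by omega
  refine ⟨fun y hy => ?_, fun i => ?_, ⟨?_, ?_⟩, ?_⟩
  · have h := simplexInterior_subset_simplexOffVertices hn
      (selfAppraisalMap_mem_simplexInterior hn0 hc hy)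
    exact ⟨h, normaliser_pos hn0 hd h⟩
  · simp only [Function.comp_apply, selfAppraisalMap_vertex]
  · exact (mapsTo_selfAppraisalMap hn hd).comp (mapsTo_selfAppraisalMap hn hc)
  · exact (continuousOn_selfAppraisalMap hn0 hd).comp (continuousOn_selfAppraisalMap hn0 hc)
      (mapsTo_selfAppraisalMap hn hc)
  · obtain ⟨s, hs, x, hx, y, hy, hyx, hxy⟩ :=
      exists_interior_solution hn0 hc hd hc2 hd2 hcs hds
    refine ⟨x, hx, ?_⟩
    rw [Function.comp_apply, selfAppraisalMap_eq_of_mul_eq hn hs hx hy.2 hyx,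
      selfAppraisalMap_eq_of_mul_eq hn hs hy hx.2 hxy]

end DeGrootFriedkin

theorem mainTheorem1 (n : ℕ) (hn : 3 ≤ n)
    (C₁ C₂ : Matrix (Fin n) (Fin n) ℝ)
    (hrow₁ : C₁ ∈ Matrix.rowStochastic ℝ (Fin n))
    (hrow₂ : C₂ ∈ Matrix.rowStochastic ℝ (Fin n))
    (hdiag₁ : ∀ i, C₁ i i = 0) (hdiag₂ : ∀ i, C₂ i i = 0)
    (hirr₁ : C₁.IsIrreducible) (hirr₂ : C₂.IsIrreducible)
    (hstar₁ : ¬ DeGrootFriedkin.HasStarTopology C₁)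
    (hstar₂ : ¬ DeGrootFriedkin.HasStarTopology C₂)
    (F₁ F₂ F₃ F₄ : (Fin n → ℝ) → (Fin n → ℝ))
    (hF₁ : F₁ = DeGrootFriedkin.selfAppraisalMap C₁)
    (hF₂ : F₂ = DeGrootFriedkin.selfAppraisalMap C₂)
    (hF₃ : F₃ = F₂ ∘ F₁) (hF₄ : F₄ = F₁ ∘ F₂) :
    -- the four properties of F₃
    ((∀ y ∈ DeGrootFriedkin.simplexOffVertices n,
        F₁ y ∈ DeGrootFriedkin.simplexOffVertices n ∧
          0 < DeGrootFriedkin.normaliser C₂ (F₁ y)) ∧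
      (∀ i : Fin n, F₃ (DeGrootFriedkin.vertex i) = DeGrootFriedkin.vertex i) ∧
      (Set.MapsTo F₃ (stdSimplex ℝ (Fin n)) (stdSimplex ℝ (Fin n)) ∧
        ContinuousOn F₃ (stdSimplex ℝ (Fin n))) ∧
      (∃ y ∈ DeGrootFriedkin.simplexInterior n, F₃ y = y)) ∧
    -- the four properties of F₄
    ((∀ y ∈ DeGrootFriedkin.simplexOffVertices n,
        F₂ y ∈ DeGrootFriedkin.simplexOffVertices n ∧
          0 < DeGrootFriedkin.normaliser C₁ (F₂ y)) ∧
      (∀ i : Fin n, F₄ (DeGrootFriedkin.vertex i) = DeGrootFriedkin.vertex i) ∧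
      (Set.MapsTo F₄ (stdSimplex ℝ (Fin n)) (stdSimplex ℝ (Fin n)) ∧
        ContinuousOn F₄ (stdSimplex ℝ (Fin n))) ∧
      (∃ y ∈ DeGrootFriedkin.simplexInterior n, F₄ y = y)) := by
  have hn0 : 0 < n := by omega
  have hc := DeGrootFriedkin.isDominantLeftEigenvector_dominantLeftEigenvector hn0 hrow₁
  have hd := DeGrootFriedkin.isDominantLeftEigenvector_dominantLeftEigenvector hn0 hrow₂
  have hcpos := hc.pos hrow₁ hirr₁
  have hdpos := hd.pos hrow₂ hirr₂
  have hc2 := hc.lt_half hrow₁ hdiag₁ hstar₁ hcpos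
  have hd2 := hd.lt_half hrow₂ hdiag₂ hstar₂ hdpos
  subst hF₁ hF₂ hF₃ hF₄
  exact ⟨DeGrootFriedkin.selfAppraisalMap_comp_properties (by omega) hcpos hdpos hc2 hd2 hc.2 hd.2,
    DeGrootFriedkin.selfAppraisalMap_comp_properties (by omega) hdpos hcpos hd2 hc2 hd.2 hc.2⟩
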